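/- Let $\mathcal X$ be a measurable space, $\mathcal Y=\{-1,+1\}$, let $\mathcal H$ be a measurable space of voters $h:\mathcal X\to\mathcal Y$ (with $(h,x)\mapsto h(x)$ measurable), let $\mathcal D$ be a probability distribution on $\mathcal X\times\mathcal Y$ with marginal $\mathcal D_{\mathcal X}$ on $\mathcal X$, $\mathcal P$ a (prior) probability distribution on $\mathcal H$, $\delta>0$ and $m\ge 1$. For a probability distribution $\mathcal Q$ on $\mathcal H$ put $$r_{\mathcal D}(\mathcal Q)=\mathbb E_{h\sim\mathcal Q}\,\mathbb E_{(x,y)\sim\mathcal D}\,\mathbf I[h(x)\neq y],\qquad d_{\mathcal D}(\mathcal Q)=\mathbb E_{h_1\sim\mathcal Q}\,\mathbb E_{h_2\sim\mathcal Q}\,\mathbb E_{x\sim\mathcal D_{\mathcal X}}\,\mathbf I[h_1(x)\neq h_2(x)],$$ and, when $r_{\mathcal D}(\mathcal Q)<\tfrac12$ (which implies $d_{\mathcal D}(\mathcal Q)<\tfrac12$), let the C-Bound be $$C_{\mathcal D}(\mathcal Q)=1-\frac{(1-2r_{\mathcal D}(\mathcal Q))^2}{1-2d_{\mathcal D}(\mathcal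 Q)}.$$ For a sample $\mathcal S=((x_i,y_i))_{i=1}^m$ put $$d_{\mathcal S}(\mathcal Q)=\frac1m\sum_{i=1}^m\mathbb E_{h_1\sim\mathcal Q}\,\mathbb E_{h_2\sim\mathcal Q}\,\mathbf I[h_1(x_i)\ne h_2(x_i)],\qquad e_{\mathcal S}(\mathcal Q)=\frac1m\sum_{i=1}^m\mathbb E_{h_1\sim\mathcal Q}\,\mathbb E_{h_2\sim\mathcal Q}\,\mathbf I[h_1(x_i)\ne y_i]\,\mathbf I[h_2(x_i)\ne y_i].$$ Let $\mathrm{kl}(q_1,q_2\|p_1,p_2)=q_1\ln\frac{q_1}{p_1}+q_2\ln\frac{q_2}{p_2}+(1-q_1-q_2)\ln\frac{1-q_1-q_2}{1-p_1-p_2}$ (with $0\ln\frac0p=0$, and $q\ln\frac q0=+\infty$ for $q>0$), let $\mathrm{KL}(\mathcal Q\|\mathcal P)\in[0,\infty]$ be the Kullback–Leibler divergence, and $$\kappa(\mathcal Q)=\frac1m\Big[2\,\mathrm{KL}(\mathcal Q\|\mathcal P)+\ln\frac{2\sqrt m+m}{\delta}\Big],$$ $$A_{\mathcal S}(\mathcal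 Q)=\big\{(e,d): e,d\ge0,\ e+d\le1,\ \mathrm{kl}(e_{\mathcal S}(\mathcal Q),d_{\mathcal S}(\mathcal Q)\|e,d)\le\kappa(\mathcal Q)\big\},$$ $$\widehat A_{\mathcal S}(\mathcal Q)=\big\{(e,d)\in A_{\mathcal S}(\mathcal Q): d\le2\sqrt{\min(e,\tfrac14)}-2e,\ d<\tfrac12\big\}.$$ Then, with probability at least $1-\delta$ over the draw of an i.i.d. sample $\mathcal S\sim\mathcal D^m$, simultaneously for every probability distribution $\mathcal Q$ on $\mathcal H$ with $r_{\mathcal D}(\mathcal Q)<\tfrac12$, $$C_{\mathcal D}(\mathcal Q)\le\sup_{(e,d)\in\widehat A_{\mathcal S}(\mathcal Q)}\left[1-\frac{\big(1-(2e+d)\big)^2}{1-2d}\right],$$ where the supremum of the empty set is $-\infty$. -/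

import Mathlib

open MeasureTheory

namespace PacBayes

noncomputable section

/-- The label space `{-1, +1}`, realised as the group of units of `ℤ`. -/
abbrev Label : Type := ℤˣ

open Classical in
/-- The indicator `I[p]`: it is `1` if the assertion `p` is true and `0` otherwise. -/
def ind (p : Prop) : ℝ := if p then 1 else 0

section Expectations

variable {X H : Type*} [MeasurableSpace X] [MeasurableSpace H]

/-- The Gibbs risk `r_D(Q)`: the `Q`-average of the true risks of the voters. -/
def gibbsRisk (vote : H → X → Label) (D : Measure (X × Label)) (Q : Measure H) : ℝ :=
  ∫ h, ∫ z, ind (vote h z.1 ≠ z.2) ∂D ∂Q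

/-- The expected disagreement `d_D(Q)`; `D.fst` is the marginal of `D` on the input space. -/
def disagreement (vote : H → X → Label) (D : Measure (X × Label)) (Q : Measure H) : ℝ :=
  ∫ h₁, ∫ h₂, ∫ x, ind (vote h₁ x ≠ vote h₂ x) ∂D.fst ∂Q ∂Q

/-- The C-Bound `C_D(Q) = 1 - (1 - 2 r_D(Q))² / (1 - 2 d_D(Q))`,
meaningful when `r_D(Q) < 1/2` (then `d_D(Q) < 1/2` too). -/
def cBound (vote : H → X → Label) (D : Measure (X × Label)) (Q : Measure H) : ℝ :=
  1 - (1 - 2 * gibbsRisk vote D Q) ^ 2 / (1 - 2 * disagreement vote D Q)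

/-- The empirical disagreement `d_S(Q)` on a sample `S` of size `m`. -/
def empDisagreement (vote : H → X → Label) {m : ℕ} (S : Fin m → X × Label)
    (Q : Measure H) : ℝ :=
  (1 / (m : ℝ)) * ∑ i, ∫ h₁, ∫ h₂, ind (vote h₁ (S i).1 ≠ vote h₂ (S i).1) ∂Q ∂Q

/-- The empirical joint error `e_S(Q)` on a sample `S` of size `m`. -/
def empJointError (vote : H → X → Label) {m : ℕ} (S : Fin m → X × Label)
    (Q : Measure H) : ℝ :=
  (1 / (m : ℝ)) * ∑ i, ∫ h₁, ∫ h₂,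
    ind (vote h₁ (S i).1 ≠ (S i).2) * ind (vote h₂ (S i).1 ≠ (S i).2) ∂Q ∂Q

end Expectations

/-- The summand `q ln (q / p)` of a discrete Kullback-Leibler divergence, for `q, p ≥ 0`, with the
usual conventions `0 ln (0 / p) = 0`, and `q ln (q / 0) = +∞` for `q > 0`. -/
def klTerm (q p : ℝ) : EReal :=
  if q = 0 then 0 else if p = 0 then ⊤ else ((q * Real.log (q / p) : ℝ) : EReal)

/-- The divergence `kl(q₁, q₂ ‖ p₁, p₂)` of the trinomial distributions with parameters
`(q₁, q₂, 1 - q₁ - q₂)` and `(p₁, p₂, 1 - p₁ - p₂)`. -/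
def trinomialKl (q₁ q₂ p₁ p₂ : ℝ) : EReal :=
  klTerm q₁ p₁ + klTerm q₂ p₂ + klTerm (1 - q₁ - q₂) (1 - p₁ - p₂)

section Bound

variable {X H : Type*} [MeasurableSpace H]

/-- `κ(Q) = (2 KL(Q‖P) + ln ((2 √m + m) / δ)) / m`, which is `+∞` if `KL(Q‖P) = +∞`. -/
def kappa (m : ℕ) (δ : ℝ) (P Q : Measure H) : EReal :=
  (2 * ((InformationTheory.klDiv Q P : ENNReal) : EReal)
      + ((Real.log ((2 * Real.sqrt m + m) / δ) : ℝ) : EReal)) / (m : EReal)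

/-- The set `A_S(Q)` of the pairs `(e, d)`, with `(e, d, 1 - e - d)` a probability vector, whose
trinomial divergence from `(e_S(Q), d_S(Q))` is at most `κ(Q)`. -/
def setA (vote : H → X → Label) {m : ℕ} (S : Fin m → X × Label) (δ : ℝ)
    (P Q : Measure H) : Set (ℝ × ℝ) :=
  {p | 0 ≤ p.1 ∧ 0 ≤ p.2 ∧ p.1 + p.2 ≤ 1 ∧
    trinomialKl (empJointError vote S Q) (empDisagreement vote S Q) p.1 p.2 ≤ kappa m δ P Q}

/-- The set `Â_S(Q)` of the `(e, d) ∈ A_S(Q)` with `d ≤ 2 √(min (e, 1/4)) - 2 e` and `d < 1/2`. -/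
def setAHat (vote : H → X → Label) {m : ℕ} (S : Fin m → X × Label) (δ : ℝ)
    (P Q : Measure H) : Set (ℝ × ℝ) :=
  {p | p ∈ setA vote S δ P Q ∧
    p.2 ≤ 2 * Real.sqrt (min p.1 (1 / 4)) - 2 * p.1 ∧ p.2 < 1 / 2}

end Bound

/-- `C^L(e, d) = 1 - (1 - (2 e + d))² / (1 - 2 d)`. -/
def cL (e d : ℝ) : ℝ := 1 - (1 - (2 * e + d)) ^ 2 / (1 - 2 * d)

end

end PacBayes

/-! Let `W z` be the `Q`-probability that a voter errs at `z`, and put `r = E W`, `e = E W²`. As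
there are only two labels, the disagreement is `d = 2r - 2e`. Hence `2e + d = 2r`, and the C-Bound
is exactly `cL e d`. It suffices that the true pair `(e, d)` lies in `Â_S(Q)`. The shape constraints
follow from `r < 1/2`, `0 ≤ W ≤ 1` and Jensen's `r² ≤ e`, which leaves a PAC-Bayesian bound on the
trinomial divergence.

A pair of voters sorts labelled points into three classes: both err, they disagree, both are right.
Pairs have prior `P ⊗ P` and posterior `Q ⊗ Q`, whose divergence is `2 KL(Q‖P)` (`klDiv_prod_self`).
For a fixed pair, the exponential moment of `m` times the empirical divergence is at most `2√m + m`
(`lintegral_expKl_le`): the class probabilities cancel, and Abel's identities evaluate the sum that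
remains (`trinomial_sum_le`). Markov's inequality for the prior average yields an event that does
not involve `Q`, and the Donsker-Varadhan inequality transfers the bound to every `Q`.

The passage from the average divergence to the divergence of the averages uses joint convexity in
dual form. The divergence is a supremum of functions affine in both arguments, so Donsker-Varadhan
is applied to each affine minorant (`sum_tangent_le`) and the supremum is taken last
(`klTerm_add_klTerm_add_klTerm_le`). Only bounded functions of the pair of voters then have to be
integrated against the posterior. -/

namespace PacBayes

/-! ### Abel's binomial identities and the constant `2√m + m` -/

section Combinatorics

open Finset Finset.Nat

/-- The truncated exponential series `∑_{k ≤ n} w ^ k / k!`. -/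
noncomputable def expTrunc (n : ℕ) (w : ℝ) : ℝ :=
  ∑ k ∈ range (n + 1), w ^ k / (k.factorial : ℝ)

lemma hasDerivAt_pow_div_factorial (k : ℕ) (c y : ℝ) :
    HasDerivAt (fun y : ℝ => (y + c) ^ (k + 1) / ((k + 1).factorial : ℝ))
      ((y + c) ^ k / (k.factorial : ℝ)) y := by
  have h := (((hasDerivAt_id y).add_const c).pow (k + 1)).div_const ((k + 1).factorial : ℝ)
  refine h.congr_deriv ?_
  have h1 : (k.factorial : ℝ) ≠ 0 := by positivity
  rw [Nat.factorial_succ]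
  push_cast
  simp only [id, mul_one]
  field_simp

lemma expTrunc_succ (n : ℕ) (w : ℝ) :
    expTrunc (n + 1) w = expTrunc n w + w ^ (n + 1) / ((n + 1).factorial : ℝ) := by
  simp [expTrunc, sum_range_succ _ (n + 1)]

lemma hasDerivAt_expTrunc (n : ℕ) (c y : ℝ) :
    HasDerivAt (fun y : ℝ => expTrunc (n + 1) (y + c)) (expTrunc n (y + c)) y := by
  unfold expTrunc
  have h : (fun y : ℝ => ∑ k ∈ range (n + 1 + 1), (y + c) ^ k / (k.factorial : ℝ)) =
      fun y => ∑ k ∈ range (n + 1), (y + c) ^ (k + 1) / ((k + 1).factorial : ℝ) + 1 := by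
    funext y
    rw [sum_range_succ']
    simp
  rw [h]
  exact (HasDerivAt.fun_sum fun k _ => hasDerivAt_pow_div_factorial k c y).add_const 1

/-- A convolution of the Abel polynomials `(y + k) ^ k / k!` with a sequence. -/
noncomputable def abelConv (f : ℕ → ℝ) (n : ℕ) (y : ℝ) : ℝ :=
  ∑ p ∈ antidiagonal n, (y + p.1) ^ p.1 / (p.1.factorial : ℝ) * f p.2

/-- Differentiation lowers the degree of an Abel polynomial and shifts its argument by one. A
convolution inherits this recursion, which is what makes induction on `n` possible. -/
lemma hasDerivAt_abelConv (f : ℕ → ℝ) (n : ℕ) (y : ℝ) :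
    HasDerivAt (abelConv f (n + 1)) (abelConv f n (y + 1)) y := by
  have h : abelConv f (n + 1) = fun y => f (n + 1) + ∑ p ∈ antidiagonal n,
      (y + ((p.1 + 1 : ℕ) : ℝ)) ^ (p.1 + 1) / ((p.1 + 1).factorial : ℝ) * f p.2 := by
    funext y
    rw [abelConv, sum_antidiagonal_succ]
    simp
  rw [h]
  refine (HasDerivAt.const_add (f (n + 1)) (HasDerivAt.fun_sum fun p _ =>
    (hasDerivAt_pow_div_factorial p.1 ((p.1 + 1 : ℕ) : ℝ) y).mul_const (f p.2))).congr_deriv ?_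
  refine sum_congr rfl fun p _ => ?_
  push_cast
  ring

/-- Two sequences of functions satisfying `u (n + 1)' = u n (· + 1)` agree if each pair agrees at
one point. -/
lemma abelConv_eq_of_hasDerivAt (f : ℕ → ℝ) (R : ℕ → ℝ → ℝ) (h0 : ∀ y, R 0 y = f 0)
    (hR : ∀ n y, HasDerivAt (R (n + 1)) (R n (y + 1)) y)
    (hp : ∀ n, ∃ y, abelConv f n y = R n y) (n : ℕ) (y : ℝ) : abelConv f n y = R n y := by
  induction n generalizing y with
  | zero => simp [abelConv, h0]
  | succ n ih =>
    obtain ⟨y₀, hy₀⟩ := hp (n + 1)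
    have hd : ∀ y, HasDerivAt (fun y => abelConv f (n + 1) y - R (n + 1) y) 0 y := fun y =>
      ((hasDerivAt_abelConv f n y).sub (hR n y)).congr_deriv (by rw [ih, sub_self])
    have := is_const_of_deriv_eq_zero (fun y => (hd y).differentiableAt)
      (fun y => (hd y).deriv) y y₀
    linarith

/-- Merging the two powers turns the sum into the `n`-th forward difference of `x ^ n`, divided by
`n!`. -/
lemma sum_antidiagonal_pow_mul_neg_pow (n : ℕ) (y : ℝ) :
    ∑ p ∈ antidiagonal n, (y + p.1) ^ p.1 / (p.1.factorial : ℝ) *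
      ((-(y + p.1)) ^ p.2 / (p.2.factorial : ℝ)) = 1 := by
  have h := congrFun (fwdDiff_iter_eq_factorial (R := ℝ) (n := n)) y
  rw [fwdDiff_iter_eq_sum_shift] at h
  have hn : (n.factorial : ℝ) ≠ 0 := by positivity
  rw [sum_antidiagonal_eq_sum_range_succ_mk]
  have h2 : ∑ k ∈ range n.succ, (y + (k : ℝ)) ^ k / (k.factorial : ℝ) *
      ((-(y + (k : ℝ))) ^ (n - k) / ((n - k).factorial : ℝ)) =
      (∑ k ∈ range (n + 1), ((-1 : ℤ) ^ (n - k) * (n.choose k : ℤ)) • (y + k • (1 : ℝ)) ^ n) /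
        (n.factorial : ℝ) := by
    rw [sum_div]
    refine sum_congr rfl fun k hk => ?_
    have hk' : k ≤ n := Nat.lt_succ_iff.mp (mem_range.mp hk)
    have hc : (n.factorial : ℝ) = n.choose k * k.factorial * (n - k).factorial := by
      exact_mod_cast (Nat.choose_mul_factorial_mul_factorial hk').symm
    have h3 : (n.choose k : ℝ) ≠ 0 := by exact_mod_cast (Nat.choose_pos hk').ne'
    rw [hc, neg_pow, ← Nat.add_sub_of_le hk', pow_add (y + k • (1 : ℝ))]
    simp only [Nat.add_sub_cancel_left, zsmul_eq_mul, nsmul_eq_mul, mul_one]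
    push_cast
    rw [Nat.add_sub_of_le hk']
    field_simp
  rw [h2, h]
  simp [hn]

lemma sum_antidiagonal_sum_range (g : ℕ → ℕ → ℝ) (n : ℕ) :
    ∑ p ∈ antidiagonal n, ∑ j ∈ range (p.2 + 1), g p.1 j =
      ∑ N ∈ range (n + 1), ∑ p ∈ antidiagonal N, g p.1 p.2 := by
  induction n with
  | zero => simp
  | succ n ih =>
    rw [sum_range_succ, ← ih, sum_antidiagonal_succ', sum_antidiagonal_succ']
    simp only [zero_add, sum_range_one, sum_range_succ _ (_ + 1), sum_add_distrib]
    ring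

/-- Cauchy's form of Abel's binomial identity. -/
lemma abelConv_pow (z : ℝ) (n : ℕ) (y : ℝ) :
    abelConv (fun j => (z + j) ^ j / (j.factorial : ℝ)) n y = expTrunc n (y + z + n) := by
  refine abelConv_eq_of_hasDerivAt _ (fun n y => expTrunc n (y + z + n)) (by simp [expTrunc])
    (fun n y => ?_) (fun n => ⟨-z - n, ?_⟩) n y
  · have := hasDerivAt_expTrunc n (z + (n + 1 : ℕ)) y
    simp only [← add_assoc] at this
    refine this.congr_deriv ?_
    push_cast
    ring_nf
  -- At `y = -z - n` one has `z + j = -(y + i)` whenever `i + j = n`, so the convolution is the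
  -- forward-difference sum, equal to `1`.
  · have h0 : expTrunc n (-z - n + z + n) = 1 := by
      rw [show -z - n + z + n = 0 by ring, expTrunc, sum_range_succ']
      simp
    rw [h0, abelConv, ← sum_antidiagonal_pow_mul_neg_pow n (-z - n)]
    refine sum_congr rfl fun p hp => ?_
    have : (n : ℝ) = p.1 + p.2 := by exact_mod_cast (mem_antidiagonal.mp hp).symm
    rw [show z + (p.2 : ℝ) = -(-z - n + p.1) by rw [this]; ring]

lemma abelConv_expTrunc (z : ℝ) (n : ℕ) (y : ℝ) :
    abelConv (fun j => expTrunc j (z + j)) n y =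
      ∑ j ∈ range (n + 1), expTrunc j (y + z + n) := by
  refine abelConv_eq_of_hasDerivAt _
    (fun n y => ∑ j ∈ range (n + 1), expTrunc j (y + z + n)) (by simp [expTrunc])
    (fun n y => ?_) (fun n => ⟨-z - n, ?_⟩) n y
  · have h : (fun y => ∑ j ∈ range (n + 1 + 1), expTrunc j (y + z + (n + 1 : ℕ))) = fun y =>
        ∑ j ∈ range (n + 1), expTrunc (j + 1) (y + (z + (n + 1 : ℕ))) + 1 := by
      funext y
      rw [sum_range_succ']
      simp [expTrunc, add_assoc]
    rw [h]
    refine ((HasDerivAt.fun_sum fun k _ =>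
      hasDerivAt_expTrunc k (z + (n + 1 : ℕ)) y).add_const 1).congr_deriv ?_
    refine sum_congr rfl fun k _ => ?_
    push_cast
    ring_nf
  -- At the same point every truncated exponential on the right is `1`. Expanding those on the left
  -- and regrouping by total degree `N ≤ n` gives forward-difference sums, each also equal to `1`.
  · have h0 : ∀ j, expTrunc j (-z - n + z + n) = 1 := fun j => by
      rw [show -z - n + z + n = 0 by ring, expTrunc, sum_range_succ']
      simp
    simp only [h0]
    rw [abelConv, sum_congr rfl fun N _ => (sum_antidiagonal_pow_mul_neg_pow N (-z - n)).symm]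
    have h1 : ∀ p ∈ antidiagonal n, (-z - (n : ℝ) + p.1) ^ p.1 / (p.1.factorial : ℝ) *
        expTrunc p.2 (z + p.2) = ∑ j ∈ range (p.2 + 1),
          (-z - (n : ℝ) + p.1) ^ p.1 / (p.1.factorial : ℝ) *
            ((-(-z - (n : ℝ) + p.1)) ^ j / (j.factorial : ℝ)) := fun p hp => by
      have : (n : ℝ) = p.1 + p.2 := by exact_mod_cast (mem_antidiagonal.mp hp).symm
      rw [← mul_sum, expTrunc, show z + (p.2 : ℝ) = -(-z - n + p.1) by rw [this]; ring]
    rw [sum_congr rfl h1]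
    exact sum_antidiagonal_sum_range (fun i j => (-z - (n : ℝ) + i) ^ i / (i.factorial : ℝ) *
      ((-(-z - (n : ℝ) + i)) ^ j / (j.factorial : ℝ))) n

lemma sum_range_expTrunc (n : ℕ) (w : ℝ) :
    ∑ j ∈ range n, expTrunc j w =
      (n - w) * expTrunc n w + w ^ (n + 1) / (n.factorial : ℝ) := by
  induction n with
  | zero => simp [expTrunc]
  | succ n ih =>
    have h1 : (n.factorial : ℝ) ≠ 0 := by positivity
    rw [sum_range_succ, ih, expTrunc_succ, Nat.factorial_succ]
    push_cast
    field_simp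
    ring

/-- With `t j` the summand, `j * t j` telescopes to total `m`. Bounding `t j` by `j * t j / K` for
`j ≥ K`, and by `j * t j / K + (1 - j / K)` for `j < K` since `t j ≤ 1`, gives `m / K + (K + 1) /
2`; the choice `K = ⌈√m⌉` makes this at most `2√m`. -/
lemma sum_descFactorial_div_pow_le (m : ℕ) (hm : 0 < m) :
    ∑ j ∈ range (m + 1), (m.descFactorial j : ℝ) / (m : ℝ) ^ j ≤ 2 * Real.sqrt m := by
  set t : ℕ → ℝ := fun j => (m.descFactorial j : ℝ) / (m : ℝ) ^ j with ht
  have hm' : (0 : ℝ) < m := by exact_mod_cast hm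
  have ht0 : ∀ j, 0 ≤ t j := fun j => by positivity
  have hstep : ∀ j ≤ m, (j : ℝ) * t j = m * (t j - t (j + 1)) := fun j hj => by
    simp only [ht]
    rw [Nat.descFactorial_succ, pow_succ]
    push_cast [Nat.cast_sub hj]
    field_simp
    ring
  have ht1 : ∀ j, t j ≤ 1 := fun j => by
    simp only [ht]
    rw [div_le_one (by positivity)]
    exact_mod_cast Nat.descFactorial_le_pow m j
  have hsum : ∑ j ∈ range (m + 1), (j : ℝ) * t j = m := by
    rw [sum_congr rfl fun j hj => hstep j (Nat.lt_succ_iff.mp (mem_range.mp hj)), ← mul_sum,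
      sum_range_sub']
    simp [ht]
  set s := Real.sqrt m with hs
  have hs2 : s ^ 2 = m := Real.sq_sqrt hm'.le
  have hs1 : 1 ≤ s := Real.one_le_sqrt.mpr (by exact_mod_cast hm)
  set K := ⌈s⌉₊ with hK
  have hK1 : s ≤ K := Nat.le_ceil s
  have hK2 : (K : ℝ) < s + 1 := Nat.ceil_lt_add_one (by linarith)
  have hK0 : (0 : ℝ) < K := by linarith
  have hKm : K ≤ m := Nat.ceil_le.mpr (by nlinarith)
  have hpos : ∑ j ∈ range K, (1 - (j : ℝ) / K) = (K + 1) / 2 := by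
    have h2 : ∀ n : ℕ, ∑ j ∈ range n, (1 - (j : ℝ) / K) = n - n * (n - 1) / (2 * K) := fun n => by
      induction n with
      | zero => simp
      | succ n ih =>
        rw [sum_range_succ, ih]
        push_cast
        field_simp
        ring
    rw [h2]
    field_simp
    ring
  have hle : ∑ j ∈ range (m + 1), t j ≤
      ∑ j ∈ range (m + 1), (j : ℝ) * t j / K + ∑ j ∈ range K, (1 - (j : ℝ) / K) := by
    have hsub : range K ⊆ range (m + 1) := range_subset_range.mpr (by omega)
    rw [← sum_sdiff hsub, ← sum_sdiff (f := fun j : ℕ => (j : ℝ) * t j / K) hsub, add_assoc,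
      ← sum_add_distrib]
    refine add_le_add (sum_le_sum fun j hj => ?_) (sum_le_sum fun j hj => ?_)
    · have hj' : (K : ℝ) ≤ j := by
        have := (mem_sdiff.mp hj).2
        rw [mem_range, not_lt] at this
        exact_mod_cast this
      rw [le_div_iff₀ hK0]
      nlinarith [ht0 j]
    · have hj' : (j : ℝ) ≤ K := by exact_mod_cast (mem_range.mp hj).le
      have h1 : (j : ℝ) / K ≤ 1 := (div_le_one hK0).mpr hj'
      have h2 : (j : ℝ) * t j / K = j / K * t j := by ring
      rw [h2]
      nlinarith [ht1 j]
  rw [← sum_div, hsum, hpos] at hle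
  refine hle.trans ?_
  have : (m : ℝ) / K ≤ 2 * s - (K + 1) / 2 := by
    rw [div_le_iff₀ hK0, ← hs2]
    nlinarith [mul_nonneg (sub_nonneg.mpr hK1) (sub_nonneg.mpr hK2.le)]
  linarith

lemma expTrunc_self_mul_le (m : ℕ) (hm : 0 < m) :
    (m.factorial : ℝ) / (m : ℝ) ^ m * expTrunc m m ≤ 2 * Real.sqrt m := by
  refine le_trans (le_of_eq ?_) (sum_descFactorial_div_pow_le m hm)
  have hm' : (m : ℝ) ≠ 0 := by exact_mod_cast hm.ne'
  rw [expTrunc, mul_sum, ← sum_range_reflect]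
  refine sum_congr rfl fun j hj => ?_
  have hj' : j ≤ m := Nat.lt_succ_iff.mp (mem_range.mp hj)
  have h1 : ((m - j).factorial : ℝ) ≠ 0 := by positivity
  have h2 : (m.factorial : ℝ) = (m - j).factorial * m.descFactorial j := by
    exact_mod_cast (Nat.factorial_mul_descFactorial hj').symm
  have h3 : (m : ℝ) ^ m = (m : ℝ) ^ (m - j) * (m : ℝ) ^ j := by
    rw [← pow_add, Nat.sub_add_cancel hj']
  rw [Nat.add_sub_cancel, h2, h3]
  field_simp

/-- The worst-case exponential moment of the empirical trinomial divergence. -/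
lemma trinomial_sum_le (m : ℕ) (hm : 0 < m) :
    ∑ p ∈ antidiagonal m, (m.choose p.1 : ℝ) * ∑ q ∈ antidiagonal p.2, (p.2.choose q.1 : ℝ) *
      (((p.1 : ℝ) / m) ^ p.1 * ((q.1 : ℝ) / m) ^ q.1 * ((q.2 : ℝ) / m) ^ q.2) ≤
      2 * Real.sqrt m + m := by
  have hm' : (m : ℝ) ≠ 0 := by exact_mod_cast hm.ne'
  have hf : (m.factorial : ℝ) ≠ 0 := by positivity
  -- At `n = w = m` the factor `n - w` in `sum_range_expTrunc` vanishes. The surviving power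
  -- contributes exactly `m` after multiplication by `m! / m ^ m`.
  have h2 : ∑ j ∈ range (m + 1), expTrunc j m =
      expTrunc m m + m * ((m : ℝ) ^ m / (m.factorial : ℝ)) := by
    rw [sum_range_succ, sum_range_expTrunc]
    ring
  have h1 : ∑ p ∈ antidiagonal m, (m.choose p.1 : ℝ) * ∑ q ∈ antidiagonal p.2,
      (p.2.choose q.1 : ℝ) *
      (((p.1 : ℝ) / m) ^ p.1 * ((q.1 : ℝ) / m) ^ q.1 * ((q.2 : ℝ) / m) ^ q.2) =
      (m.factorial : ℝ) / (m : ℝ) ^ m * ∑ j ∈ range (m + 1), expTrunc j m := by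
    -- The multinomial coefficients split into factorials, leaving Abel polynomials at `0`. The
    -- inner sum is `abelConv_pow` and the outer one `abelConv_expTrunc`.
    have := abelConv_expTrunc 0 m 0
    simp only [zero_add] at this
    rw [← this, abelConv, mul_sum]
    refine sum_congr rfl fun p hp => ?_
    have hp' := mem_antidiagonal.mp hp
    have h3 := abelConv_pow 0 p.2 0
    simp only [zero_add] at h3
    rw [← h3, abelConv, mul_sum, mul_sum, mul_sum]
    refine sum_congr rfl fun q hq => ?_
    have hq' := mem_antidiagonal.mp hq
    have e1 : (m.factorial : ℝ) = m.choose p.1 * p.1.factorial * p.2.factorial := by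
      rw [← hp']
      rw [Nat.choose_symm_add]
      exact_mod_cast (Nat.add_choose_mul_factorial_mul_factorial p.1 p.2).symm
    have e2 : (p.2.factorial : ℝ) = p.2.choose q.1 * q.1.factorial * q.2.factorial := by
      rw [← hq']
      rw [Nat.choose_symm_add]
      exact_mod_cast (Nat.add_choose_mul_factorial_mul_factorial q.1 q.2).symm
    have e3 : (m : ℝ) ^ m = (m : ℝ) ^ p.1 * (m : ℝ) ^ q.1 * (m : ℝ) ^ q.2 := by
      rw [← pow_add, ← pow_add, add_assoc, hq', hp']
    have f1 : (p.1.factorial : ℝ) ≠ 0 := by positivity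
    have f2 : (q.1.factorial : ℝ) ≠ 0 := by positivity
    have f3 : (q.2.factorial : ℝ) ≠ 0 := by positivity
    rw [e1, e2, e3]
    simp only [zero_add, div_pow]
    field_simp
  rw [h1, h2, mul_add]
  refine add_le_add (expTrunc_self_mul_le m hm) (le_of_eq ?_)
  field_simp

end Combinatorics

/-! ### The exponential moment of the empirical divergence -/

section Moment

open Finset

/-- The number of indices at which `s` takes the value `c`. -/
def count {m : ℕ} (s : Fin m → Fin 3) (c : Fin 3) : ℕ := #{i | s i = c}

lemma count_le {m : ℕ} (s : Fin m → Fin 3) (c : Fin 3) : count s c ≤ m :=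
  (card_le_univ _).trans_eq (Fintype.card_fin m)

lemma prod_comp_eq_prod_pow_count {M : Type*} [CommMonoid M] {m : ℕ} (s : Fin m → Fin 3)
    (f : Fin 3 → M) : ∏ i, f (s i) = ∏ c, f c ^ count s c := by
  rw [← Finset.prod_fiberwise' univ s f]
  simp [count]

/-- A sequence is determined by the sets `U`, `V` where it takes the values `0` and `1`, and `V`
avoids `U`. Since `g ≥ 0`, injectivity of this encoding is enough. -/
lemma sum_count_le {m : ℕ} (g : ℕ → ℕ → ℕ → ℝ) (hg : ∀ i j k, 0 ≤ g i j k) :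
    ∑ s : Fin m → Fin 3, g (count s 0) (count s 1) (count s 2) ≤
      ∑ p ∈ antidiagonal m, (m.choose p.1 : ℝ) *
        ∑ q ∈ antidiagonal p.2, (p.2.choose q.1 : ℝ) * g p.1 q.1 q.2 := by
  have h1 : ∑ p ∈ antidiagonal m, (m.choose p.1 : ℝ) *
        ∑ q ∈ antidiagonal p.2, (p.2.choose q.1 : ℝ) * g p.1 q.1 q.2 =
      ∑ U ∈ (univ : Finset (Fin m)).powerset, ∑ V ∈ (univ \ U).powerset,
        g #U #V (m - #U - #V) := by
    have h2 : ∀ U : Finset (Fin m), ∑ V ∈ (univ \ U).powerset, g #U #V (m - #U - #V) =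
        ∑ q ∈ antidiagonal (m - #U), ((m - #U).choose q.1 : ℝ) * g #U q.1 q.2 := fun U => by
      rw [sum_powerset_apply_card (fun j => g #U j (m - #U - j)), card_sdiff_of_subset
        (subset_univ U), card_univ, Fintype.card_fin,
        Finset.Nat.sum_antidiagonal_eq_sum_range_succ
          (fun i j => ((m - #U).choose i : ℝ) * g #U i j)]
      simp
    simp only [h2]
    rw [sum_powerset_apply_card (fun u => ∑ q ∈ antidiagonal (m - u),
      ((m - u).choose q.1 : ℝ) * g u q.1 q.2), card_univ, Fintype.card_fin,
      Finset.Nat.sum_antidiagonal_eq_sum_range_succ (fun i r => (m.choose i : ℝ) *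
        ∑ q ∈ antidiagonal r, (r.choose q.1 : ℝ) * g i q.1 q.2)]
    simp
  rw [h1, sum_sigma']
  set φ : (Fin m → Fin 3) → (_ : Finset (Fin m)) × Finset (Fin m) :=
    fun s => ⟨univ.filter fun i => s i = 0, univ.filter fun i => s i = 1⟩ with hφ
  have hinj : Function.Injective φ := fun s s' h => by
    simp only [hφ, Sigma.mk.injEq, heq_eq_eq] at h
    funext i
    have h0 : s i = 0 ↔ s' i = 0 := by simpa using Finset.ext_iff.mp h.1 i
    have h1 : s i = 1 ↔ s' i = 1 := by simpa using Finset.ext_iff.mp h.2 i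
    omega
  have hval : ∀ s : Fin m → Fin 3, g (count s 0) (count s 1) (count s 2) =
      (fun x : (_ : Finset (Fin m)) × Finset (Fin m) => g #x.1 #x.2 (m - #x.1 - #x.2)) (φ s) :=
    fun s => by
    have hs : count s 0 + count s 1 + count s 2 = m := by
      have := card_eq_sum_card_fiberwise (s := (univ : Finset (Fin m))) (t := univ)
        (f := s) (by simp)
      rw [card_univ, Fintype.card_fin, Fin.sum_univ_three] at this
      exact this.symm
    have h2 : count s 2 = m - count s 0 - count s 1 := by omega
    rw [h2]
    rfl
  rw [sum_congr rfl fun s _ => hval s, ← sum_image (s := univ) (g := φ)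
    (f := fun x => g #x.1 #x.2 (m - #x.1 - #x.2)) hinj.injOn]
  refine sum_le_sum_of_subset_of_nonneg (fun x hx => ?_) fun _ _ _ => hg _ _ _
  obtain ⟨s, -, rfl⟩ := mem_image.mp hx
  simp only [hφ, mem_sigma, mem_powerset, subset_univ, true_and]
  intro i hi
  simp only [mem_filter_univ] at hi
  simp [hi]

/-- The exponential of `m` times the divergence of the empirical class frequencies of `s` from
the class probabilities `p`. -/
noncomputable def expKl {m : ℕ} (s : Fin m → Fin 3) (p : Fin 3 → ENNReal) : ENNReal :=
  ∏ c, ((count s c : ENNReal) / (m * p c)) ^ count s c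

/-- The class probabilities cancel, so the bound no longer depends on them. Equality can fail at a
class of probability zero, where the left factor is `⊤ * 0 = 0` if the class occurs in `s`. -/
lemma expKl_mul_prod_le {m : ℕ} (s : Fin m → Fin 3) (p : Fin 3 → ENNReal)
    (hp : ∀ c, p c ≠ ⊤) :
    expKl s p * ∏ i, p (s i) ≤ ∏ c, ((count s c : ENNReal) / m) ^ count s c := by
  rw [prod_comp_eq_prod_pow_count s p, expKl, ← prod_mul_distrib]
  refine prod_le_prod' fun c _ => ?_
  rw [← mul_pow]
  refine pow_le_pow_left₀ bot_le ?_ _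
  rcases eq_or_ne (p c) 0 with h | h
  · simp [h]
  · rw [← ENNReal.mul_div_mul_right (count s c : ENNReal) m h (hp c), div_eq_mul_inv,
      div_eq_mul_inv]
    exact le_of_eq (by ring)

lemma lintegral_expKl_le {Z : Type*} [MeasurableSpace Z] (D : Measure Z)
    [IsProbabilityMeasure D] {m : ℕ} (hm : 0 < m) (cat : Z → Fin 3) (hcat : Measurable cat) :
    ∫⁻ S, expKl (fun i => cat (S i)) (fun c => D (cat ⁻¹' {c})) ∂(Measure.pi fun _ : Fin m => D) ≤
      ENNReal.ofReal (2 * Real.sqrt m + m) := by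
  set p : Fin 3 → ENNReal := fun c => D (cat ⁻¹' {c}) with hp
  set A : (Fin m → Fin 3) → Set (Fin m → Z) := fun s => Set.univ.pi fun i => cat ⁻¹' {s i} with hA
  have hAm : ∀ s, MeasurableSet (A s) := fun s =>
    MeasurableSet.univ_pi fun i => hcat (measurableSet_singleton _)
  have hm' : (0 : ℝ) < m := by exact_mod_cast hm
  calc ∫⁻ S, expKl (fun i => cat (S i)) p ∂(Measure.pi fun _ : Fin m => D)
      ≤ ∫⁻ S, ∑ s, (A s).indicator (fun _ => expKl s p) S ∂(Measure.pi fun _ : Fin m => D) := by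
        refine lintegral_mono fun S => ?_
        have hS : S ∈ A (fun i => cat (S i)) := by simp [hA]
        refine le_trans (le_of_eq ?_) (single_le_sum
          (f := fun s => (A s).indicator (fun _ => expKl s p) S) (fun _ _ => bot_le)
          (mem_univ fun i => cat (S i)))
        rw [Set.indicator_of_mem hS]
    _ = ∑ s, expKl s p * ∏ i, p (s i) := by
        rw [lintegral_finsetSum _ fun s _ => measurable_const.indicator (hAm s)]
        refine sum_congr rfl fun s _ => ?_
        rw [lintegral_indicator_const (hAm s), Measure.pi_pi]
    _ ≤ ∑ s : Fin m → Fin 3, ∏ c, ((count s c : ENNReal) / m) ^ count s c :=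
        sum_le_sum fun s _ => expKl_mul_prod_le s p fun c => measure_ne_top _ _
    _ = ENNReal.ofReal (∑ s : Fin m → Fin 3, ((count s 0 / m : ℝ) ^ count s 0 *
          (count s 1 / m : ℝ) ^ count s 1 * (count s 2 / m : ℝ) ^ count s 2)) := by
        rw [ENNReal.ofReal_sum_of_nonneg fun s _ => by positivity]
        refine sum_congr rfl fun s _ => ?_
        rw [Fin.prod_univ_three, ENNReal.ofReal_mul (by positivity),
          ENNReal.ofReal_mul (by positivity)]
        have hof : ∀ k : ℕ, ENNReal.ofReal ((k / m : ℝ) ^ k) = ((k : ENNReal) / m) ^ k :=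
          fun k => by
            rw [ENNReal.ofReal_pow (by positivity), ENNReal.ofReal_div_of_pos hm',
              ENNReal.ofReal_natCast, ENNReal.ofReal_natCast]
        rw [hof, hof, hof]
    _ ≤ _ := ENNReal.ofReal_le_ofReal ((sum_count_le
        (fun i j k => (i / m : ℝ) ^ i * (j / m : ℝ) ^ j * (k / m : ℝ) ^ k)
        fun _ _ _ => by positivity).trans (trinomial_sum_le m hm))

lemma measurable_count {α : Type*} [MeasurableSpace α] {m : ℕ} {f : α → Fin m → Fin 3}
    (hf : ∀ i, Measurable fun a => f a i) (c : Fin 3) : Measurable fun a => count (f a) c := by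
  simp only [count, card_filter]
  exact Finset.measurable_sum _ fun i _ =>
    Measurable.ite (hf i (measurableSet_singleton c)) measurable_const measurable_const

variable {Θ Z : Type*} [MeasurableSpace Θ] [MeasurableSpace Z]

lemma measurable_classProb (D : Measure Z) [SFinite D] {cat : Θ → Z → Fin 3}
    (hcat : Measurable (Function.uncurry cat)) (c : Fin 3) :
    Measurable fun θ => D (cat θ ⁻¹' {c}) :=
  measurable_measure_prodMk_left (hcat (measurableSet_singleton c))

lemma measurable_expKl (D : Measure Z) [SFinite D] {m : ℕ} {cat : Θ → Z → Fin 3}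
    (hcat : Measurable (Function.uncurry cat)) :
    Measurable fun q : (Fin m → Z) × Θ =>
      expKl (fun i => cat q.2 (q.1 i)) (fun c => D (cat q.2 ⁻¹' {c})) := by
  unfold expKl
  refine Finset.measurable_prod _ fun c _ => ?_
  have h1 : Measurable fun q : (Fin m → Z) × Θ => count (fun i => cat q.2 (q.1 i)) c :=
    measurable_count (f := fun (q : (Fin m → Z) × Θ) i => cat q.2 (q.1 i)) (fun i =>
      hcat.comp (measurable_snd.prodMk ((measurable_pi_apply i).comp measurable_fst))) c
  have h2 : Measurable fun q : (Fin m → Z) × Θ => D (cat q.2 ⁻¹' {c}) :=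
    (measurable_classProb D hcat c).comp measurable_snd
  have h3 : Measurable fun q : (Fin m → Z) × Θ =>
      ((count (fun i => cat q.2 (q.1 i)) c : ℕ) : ENNReal) := measurable_from_nat.comp h1
  exact (h3.div (h2.const_mul _)).pow h1

/-- Markov's inequality for the prior average of the exponential divergence. -/
lemma exists_measurableSet_lintegral_expKl_le (D : Measure Z) [IsProbabilityMeasure D]
    (ν : Measure Θ) [IsProbabilityMeasure ν] {cat : Θ → Z → Fin 3}
    (hcat : Measurable (Function.uncurry cat)) {m : ℕ} (hm : 0 < m) {δ : ℝ} (hδ : 0 < δ) :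
    ∃ G : Set (Fin m → Z), MeasurableSet G ∧ 1 - δ ≤ (Measure.pi fun _ : Fin m => D).real G ∧
      ∀ S ∈ G, ∫⁻ θ, expKl (fun i => cat θ (S i)) (fun c => D (cat θ ⁻¹' {c})) ∂ν ≤
        ENNReal.ofReal ((2 * Real.sqrt m + m) / δ) := by
  have hmeas := measurable_expKl D (m := m) hcat
  set I : (Fin m → Z) → ENNReal := fun S =>
    ∫⁻ θ, expKl (fun i => cat θ (S i)) (fun c => D (cat θ ⁻¹' {c})) ∂ν with hI
  have hIm : Measurable I := hmeas.lintegral_prod_right'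
  set ξ : ℝ := 2 * Real.sqrt m + m with hξ
  have hm' : (0 : ℝ) < m := by exact_mod_cast hm
  have hξ0 : 0 < ξ := by positivity
  have hGm : MeasurableSet {S | I S ≤ ENNReal.ofReal (ξ / δ)} := hIm measurableSet_Iic
  refine ⟨{S | I S ≤ ENNReal.ofReal (ξ / δ)}, hGm, ?_, fun S hS => hS⟩
  -- The prior does not depend on the sample, so the integrals can be exchanged and the moment bound
  -- applied at each fixed `θ`.
  have hint : ∫⁻ S, I S ∂(Measure.pi fun _ : Fin m => D) ≤ ENNReal.ofReal ξ := by
    simp only [hI]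
    rw [lintegral_lintegral_swap hmeas.aemeasurable]
    calc _ ≤ ∫⁻ _, ENNReal.ofReal ξ ∂ν := lintegral_mono fun θ =>
          lintegral_expKl_le D hm (cat θ) (hcat.comp measurable_prodMk_left)
      _ = _ := by simp
  have hmk := (mul_meas_ge_le_lintegral (μ := Measure.pi fun _ : Fin m => D) hIm
    (ENNReal.ofReal (ξ / δ))).trans hint
  have hc : (Measure.pi fun _ : Fin m => D) {S | I S ≤ ENNReal.ofReal (ξ / δ)}ᶜ ≤
      ENNReal.ofReal δ := by
    refine (measure_mono (t := {S | ENNReal.ofReal (ξ / δ) ≤ I S})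
      fun S hS => show _ ≤ I S from (not_le.mp hS).le).trans ?_
    have h0 : ENNReal.ofReal (ξ / δ) ≠ 0 := (ENNReal.ofReal_pos.mpr (by positivity)).ne'
    rw [← ENNReal.mul_le_mul_iff_right h0 ENNReal.ofReal_ne_top,
      ← ENNReal.ofReal_mul (p := ξ / δ) (by positivity), div_mul_cancel₀ _ hδ.ne']
    exact hmk
  have := probReal_add_probReal_compl (μ := Measure.pi fun _ : Fin m => D) hGm
  have h2 : (Measure.pi fun _ : Fin m => D).real {S | I S ≤ ENNReal.ofReal (ξ / δ)}ᶜ ≤ δ :=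
    ENNReal.toReal_le_of_le_ofReal hδ.le hc
  linarith

end Moment

/-! ### Change of measure and the divergence of product measures -/

section ChangeOfMeasure

open InformationTheory ProbabilityTheory

variable {Θ : Type*} [MeasurableSpace Θ]

/-- The Donsker-Varadhan inequality. -/
lemma integral_le_toReal_klDiv_add_log (μ ν : Measure Θ) [IsProbabilityMeasure μ]
    [IsProbabilityMeasure ν] (h : klDiv μ ν ≠ ⊤) {ψ : Θ → ℝ} (hψ : Measurable ψ)
    (hi : Integrable ψ μ) {B : ℝ} (hB : 0 < B)
    (hle : ∫⁻ θ, ENNReal.ofReal (Real.exp (ψ θ)) ∂ν ≤ ENNReal.ofReal B) :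
    ∫ θ, ψ θ ∂μ ≤ (klDiv μ ν).toReal + Real.log B := by
  obtain ⟨hac, hllr⟩ := klDiv_ne_top_iff.mp h
  have hum : Measurable fun θ => ψ θ - llr μ ν θ := hψ.sub (measurable_llr μ ν)
  have hem : Measurable fun θ => Real.exp (ψ θ - llr μ ν θ) := hum.exp
  have h1 : ∫⁻ θ, ENNReal.ofReal (Real.exp (ψ θ - llr μ ν θ)) ∂μ ≤ ENNReal.ofReal B := by
    -- The density cancels `exp (-llr)` wherever it is nonzero and finite; where it vanishes the
    -- integrand is `0`, so an inequality suffices.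
    rw [← lintegral_rnDeriv_mul hac hem.ennreal_ofReal.aemeasurable]
    refine le_trans (lintegral_mono_ae ?_) hle
    filter_upwards [Measure.rnDeriv_lt_top μ ν] with θ hθ
    rcases eq_or_ne (μ.rnDeriv ν θ) 0 with h0 | h0
    · simp [h0]
    · have hpos : 0 < (μ.rnDeriv ν θ).toReal := ENNReal.toReal_pos h0 hθ.ne
      rw [llr, Real.exp_sub, Real.exp_log hpos]
      nth_rewrite 1 [← ENNReal.ofReal_toReal hθ.ne]
      rw [← ENNReal.ofReal_mul hpos.le, mul_div_cancel₀ _ hpos.ne']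
  have hint : Integrable (fun θ => Real.exp (ψ θ - llr μ ν θ)) μ :=
    (lintegral_ofReal_ne_top_iff_integrable hem.aestronglyMeasurable
      (ae_of_all _ fun _ => (Real.exp_pos _).le)).mp (h1.trans_lt ENNReal.ofReal_lt_top).ne
  have h2 : ∫ θ, Real.exp (ψ θ - llr μ ν θ) ∂μ ≤ B := by
    rw [← ENNReal.ofReal_le_ofReal_iff hB.le, ofReal_integral_eq_lintegral_ofReal hint
      (ae_of_all _ fun _ => (Real.exp_pos _).le)]
    exact h1
  -- Jensen's inequality for `exp`; the integral of `llr` under `μ` is the divergence.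
  have h3 : Real.exp (∫ θ, (ψ θ - llr μ ν θ) ∂μ) ≤ ∫ θ, Real.exp (ψ θ - llr μ ν θ) ∂μ :=
    convexOn_exp.map_integral_le Real.continuous_exp.continuousOn isClosed_univ
      (ae_of_all _ fun _ => Set.mem_univ _) (hi.sub hllr) hint
  rw [integral_sub hi hllr] at h3
  have h4 := (Real.le_log_iff_exp_le hB).mpr (h3.trans h2)
  rw [toReal_klDiv_of_measure_eq hac (by simp)]
  linarith

/-- This is the chain rule, with products read as compositions with constant kernels. The
conditional term is brought to the first coordinate by the swap map; data processing in both
directions shows that swapping preserves the divergence. -/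
lemma klDiv_prod_self (μ ν : Measure Θ) [IsProbabilityMeasure μ] [IsProbabilityMeasure ν] :
    klDiv (μ.prod μ) (ν.prod ν) = 2 * klDiv μ ν := by
  have hswap : ∀ α β : Measure Θ, IsProbabilityMeasure α → IsProbabilityMeasure β →
      klDiv (μ.prod α) (μ.prod β) ≤ klDiv (α.prod μ) (β.prod μ) := fun α β _ _ => by
    rw [← Measure.prod_swap (μ := α) (ν := μ), ← Measure.prod_swap (μ := β) (ν := μ)]
    exact klDiv_map_le _ _ measurable_swap
  have hswap' : ∀ α β : Measure Θ, IsProbabilityMeasure α → IsProbabilityMeasure β →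
      klDiv (α.prod μ) (β.prod μ) ≤ klDiv (μ.prod α) (μ.prod β) := fun α β _ _ => by
    rw [← Measure.prod_swap (μ := μ) (ν := α), ← Measure.prod_swap (μ := μ) (ν := β)]
    exact klDiv_map_le _ _ measurable_swap
  have hleft : klDiv (μ.prod μ) (ν.prod μ) = klDiv μ ν := by
    rw [← Measure.compProd_const, ← Measure.compProd_const]
    exact klDiv_compProd_left μ ν _
  rw [← Measure.compProd_const (μ := μ), ← Measure.compProd_const (μ := ν),
    klDiv_compProd_eq_add, Measure.compProd_const, Measure.compProd_const,
    le_antisymm (hswap μ ν ‹_› ‹_›) (hswap' μ ν ‹_› ‹_›), hleft, two_mul]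

end ChangeOfMeasure

/-! ### The divergence as a supremum of affine functions -/

section Tangent

/-- The exponent is an affine minorant of `k log (k / (m p))`, by `log x ≤ x - 1` at `x = t / (k /
(m p))`. It stays finite when `p = 0`. -/
lemma ofReal_exp_le_pow (m : ℕ) (hm : 0 < m) (k : ℕ) {p : ENNReal} (hp : p ≠ ⊤) {t : ℝ}
    (ht : 0 < t) :
    ENNReal.ofReal (Real.exp (k * Real.log t + k - m * p.toReal * t)) ≤
      ((k : ENNReal) / (m * p)) ^ k := by
  have hm' : (0 : ℝ) < m := by exact_mod_cast hm
  rcases Nat.eq_zero_or_pos k with rfl | hk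
  · have : 0 ≤ m * p.toReal * t := by positivity
    simpa using this
  have hk' : (0 : ℝ) < k := by exact_mod_cast hk
  rcases eq_or_ne p 0 with rfl | h0
  · rw [mul_zero, ENNReal.div_zero (by exact_mod_cast hk.ne'), ENNReal.top_pow hk.ne']
    exact le_top
  set r := p.toReal with hr
  have hr0 : 0 < r := ENNReal.toReal_pos h0 hp
  have h1 : ((k : ENNReal) / (m * p)) ^ k = ENNReal.ofReal ((k / (m * r)) ^ k) := by
    rw [ENNReal.ofReal_pow (by positivity), ENNReal.ofReal_div_of_pos (by positivity),
      ENNReal.ofReal_mul hm'.le, hr, ENNReal.ofReal_toReal hp, ENNReal.ofReal_natCast,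
      ENNReal.ofReal_natCast]
  rw [h1]
  refine ENNReal.ofReal_le_ofReal ?_
  have hpos : 0 < (k : ℝ) / (m * r) := by positivity
  rw [← Real.exp_log (pow_pos hpos k), Real.exp_le_exp, Real.log_pow]
  have h2 := Real.log_le_sub_one_of_pos (show 0 < t / (k / (m * r)) by positivity)
  rw [Real.log_div ht.ne' hpos.ne'] at h2
  have h3 : (k : ℝ) * (t / (k / (m * r))) = m * r * t := by field_simp
  nlinarith [mul_le_mul_of_nonneg_left h2 hk'.le]

/-- `klTerm q p` is a supremum of functions that are affine in `(q, p)`. -/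
lemma exists_lt_tangent {q p : ℝ} (hq : 0 ≤ q) (hp : 0 ≤ p) {b : EReal} (hb : b < klTerm q p) :
    ∃ t : ℝ, 0 < t ∧ b < ((q * Real.log t + q - p * t : ℝ) : EReal) := by
  rcases hq.eq_or_lt with rfl | hq
  · simp only [klTerm, if_true] at hb
    obtain ⟨c, hbc, hc⟩ := EReal.lt_iff_exists_real_btwn.mp hb
    have hc0 : c < 0 := by exact_mod_cast hc
    -- Here `q = 0` and the affine function is `-p t`, so a small `t` is needed; the `+ 1` covers `p
    -- = 0`.
    refine ⟨-c / (p + 1), div_pos (by linarith) (by linarith), hbc.trans_le ?_⟩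
    rw [EReal.coe_le_coe_iff]
    have h1 : p * (-c / (p + 1)) ≤ -c := by
      rw [mul_div_assoc', div_le_iff₀ (by linarith)]
      nlinarith
    linarith
  rcases hp.eq_or_lt with rfl | hp
  · obtain ⟨c, hbc, -⟩ := EReal.lt_iff_exists_real_btwn.mp (hb.trans_le le_top)
    -- For `p = 0` the affine function is unbounded in `t`; this choice gives it the value `c + q`.
    refine ⟨Real.exp (c / q), Real.exp_pos _, hbc.trans ?_⟩
    rw [EReal.coe_lt_coe_iff, Real.log_exp, mul_div_cancel₀ _ hq.ne']
    linarith
  -- The point of tangency, where the affine function equals `klTerm q p`.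
  · refine ⟨q / p, by positivity, ?_⟩
    rw [klTerm, if_neg hq.ne', if_neg hp.ne'] at hb
    rwa [mul_div_cancel₀ _ hp.ne', add_sub_cancel_right]

lemma klTerm_add_le {q p : ℝ} (hq : 0 ≤ q) (hp : 0 ≤ p) {a κ : EReal}
    (h : ∀ t : ℝ, 0 < t → ((q * Real.log t + q - p * t : ℝ) : EReal) + a ≤ κ) :
    klTerm q p + a ≤ κ := by
  refine EReal.add_le_of_forall_lt fun b hb a' ha => ?_
  obtain ⟨t, ht, hbt⟩ := exists_lt_tangent hq hp hb
  exact (add_le_add hbt.le ha.le).trans (h t ht)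

/-- The slopes `t c` vary independently, so the three suprema can be taken one term at a time. -/
lemma klTerm_add_klTerm_add_klTerm_le {q p : Fin 3 → ℝ} (hq : ∀ c, 0 ≤ q c) (hp : ∀ c, 0 ≤ p c)
    {κ : EReal} (h : ∀ t : Fin 3 → ℝ, (∀ c, 0 < t c) →
      ((∑ c, (q c * Real.log (t c) + q c - p c * t c) : ℝ) : EReal) ≤ κ) :
    klTerm (q 0) (p 0) + klTerm (q 1) (p 1) + klTerm (q 2) (p 2) ≤ κ := by
  rw [add_assoc]
  refine klTerm_add_le (hq 0) (hp 0) fun t₀ h₀ => ?_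
  rw [add_left_comm]
  refine klTerm_add_le (hq 1) (hp 1) fun t₁ h₁ => ?_
  rw [← add_assoc, add_comm]
  refine klTerm_add_le (hq 2) (hp 2) fun t₂ h₂ => ?_
  refine le_trans (le_of_eq ?_) (h ![t₀, t₁, t₂] (by simp [Fin.forall_fin_succ, h₀, h₁, h₂]))
  rw [Fin.sum_univ_three, ← EReal.coe_add, ← EReal.coe_add, EReal.coe_eq_coe_iff]
  simp only [Matrix.cons_val]
  ring

end Tangent

/-! ### Indicators and their integrals -/

lemma ind_nonneg (p : Prop) : 0 ≤ ind p := by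
  unfold ind
  split_ifs <;> norm_num

lemma ind_le_one (p : Prop) : ind p ≤ 1 := by
  unfold ind
  split_ifs <;> norm_num

lemma measurable_ind {α : Type*} [MeasurableSpace α] {p : α → Prop}
    (hp : MeasurableSet {a | p a}) : Measurable fun a => ind (p a) := by
  classical
  have : (fun a => ind (p a)) = fun a => if p a then (1 : ℝ) else 0 := by
    funext a
    simp only [ind]
  rw [this]
  exact Measurable.ite hp measurable_const measurable_const

lemma integrable_ind {α : Type*} [MeasurableSpace α] (μ : Measure α) [IsFiniteMeasure μ]
    {p : α → Prop} (hp : MeasurableSet {a | p a}) : Integrable (fun a => ind (p a)) μ :=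
  Integrable.of_bound (measurable_ind hp).aestronglyMeasurable 1 (ae_of_all _ fun a => by
    rw [Real.norm_of_nonneg (ind_nonneg _)]
    exact ind_le_one _)

lemma integral_ind {α : Type*} [MeasurableSpace α] (μ : Measure α)
    {p : α → Prop} (hp : MeasurableSet {a | p a}) : ∫ a, ind (p a) ∂μ = μ.real {a | p a} := by
  rw [← integral_indicator_one hp]
  refine integral_congr_ae (ae_of_all _ fun a => ?_)
  by_cases h : p a <;> simp [ind, Set.indicator, h]

instance : MeasurableSingletonClass Label :=
  ⟨fun u => ⟨{(u : ℤ)}, measurableSet_singleton _, by ext; simp [Units.ext_iff]⟩⟩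

/-! ### Posterior class frequencies and the averaged affine bound -/

section ClassFreq

variable {Θ Z : Type*} [MeasurableSpace Θ]

/-- The posterior probability that the point `z` falls in the class `c`. -/
noncomputable def classFreq (cat : Θ → Z → Fin 3) (μ : Measure Θ) (c : Fin 3) (z : Z) : ℝ :=
  ∫ θ, ind (cat θ z = c) ∂μ

lemma classFreq_nonneg (cat : Θ → Z → Fin 3) (μ : Measure Θ) (c : Fin 3) (z : Z) :
    0 ≤ classFreq cat μ c z := integral_nonneg fun _ => ind_nonneg _

variable [MeasurableSpace Z]

lemma measurableSet_cat {cat : Θ → Z → Fin 3} (hcat : Measurable (Function.uncurry cat))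
    (c : Fin 3) (z : Z) : MeasurableSet {θ | cat θ z = c} :=
  (hcat.comp measurable_prodMk_right) (measurableSet_singleton c)

lemma integral_toReal_classProb (D : Measure Z) [IsProbabilityMeasure D] (μ : Measure Θ)
    [IsProbabilityMeasure μ] {cat : Θ → Z → Fin 3} (hcat : Measurable (Function.uncurry cat))
    (c : Fin 3) :
    ∫ θ, (D (cat θ ⁻¹' {c})).toReal ∂μ = ∫ z, classFreq cat μ c z ∂D := by
  unfold classFreq
  rw [integral_integral_swap]
  · refine integral_congr_ae (ae_of_all _ fun θ => ?_)
    exact (integral_ind D (p := fun z => cat θ z = c)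
      ((hcat.comp measurable_prodMk_left) (measurableSet_singleton c))).symm
  · exact integrable_ind (D.prod μ) (p := fun x : Z × Θ => cat x.2 x.1 = c)
      ((hcat.comp measurable_swap) (measurableSet_singleton c))

lemma integral_count {m : ℕ} (μ : Measure Θ) [IsProbabilityMeasure μ] {cat : Θ → Z → Fin 3}
    (hcat : Measurable (Function.uncurry cat)) (S : Fin m → Z) (c : Fin 3) :
    ∫ θ, (count (fun i => cat θ (S i)) c : ℝ) ∂μ = ∑ i, classFreq cat μ c (S i) := by
  unfold classFreq
  rw [← integral_finsetSum _ fun i _ => integrable_ind μ (measurableSet_cat hcat c (S i))]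
  refine integral_congr_ae (ae_of_all _ fun θ => ?_)
  simp only [count, Finset.card_filter, ind]
  push_cast
  refine Finset.sum_congr rfl fun i _ => ?_
  split_ifs <;> rfl

/-- The change of measure, with the empirical divergence replaced by an affine minorant. -/
lemma sum_tangent_le (D : Measure Z) [IsProbabilityMeasure D] (μ ν : Measure Θ)
    [IsProbabilityMeasure μ] [IsProbabilityMeasure ν] {cat : Θ → Z → Fin 3}
    (hcat : Measurable (Function.uncurry cat)) {m : ℕ} (hm : 0 < m) (S : Fin m → Z) {B : ℝ}
    (hB : 0 < B)
    (hS : ∫⁻ θ, expKl (fun i => cat θ (S i)) (fun c => D (cat θ ⁻¹' {c})) ∂ν ≤ ENNReal.ofReal B)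
    (hkl : InformationTheory.klDiv μ ν ≠ ⊤) (t : Fin 3 → ℝ) (ht : ∀ c, 0 < t c) :
    ∑ c, ((1 / (m : ℝ) * ∑ i, classFreq cat μ c (S i)) * Real.log (t c) +
        1 / (m : ℝ) * ∑ i, classFreq cat μ c (S i) - (∫ z, classFreq cat μ c z ∂D) * t c) ≤
      ((InformationTheory.klDiv μ ν).toReal + Real.log B) / m := by
  have hm' : (0 : ℝ) < m := by exact_mod_cast hm
  set k : Θ → Fin 3 → ℕ := fun θ c => count (fun i => cat θ (S i)) c with hk
  set p : Θ → Fin 3 → ENNReal := fun θ c => D (cat θ ⁻¹' {c}) with hp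
  have hkm : ∀ c, Measurable fun θ => (k θ c : ℝ) := fun c =>
    measurable_from_nat.comp (measurable_count (f := fun θ i => cat θ (S i))
      (fun i => hcat.comp measurable_prodMk_right) c)
  have hpm : ∀ c, Measurable fun θ => (p θ c).toReal := fun c =>
    (measurable_classProb D hcat c).ennreal_toReal
  have hki : ∀ c, Integrable (fun θ => (k θ c : ℝ)) μ := fun c =>
    Integrable.of_bound (hkm c).aestronglyMeasurable m (ae_of_all _ fun θ => by
      rw [Real.norm_of_nonneg (by positivity)]
      exact_mod_cast count_le _ _)
  have hpi : ∀ c, Integrable (fun θ => (p θ c).toReal) μ := fun c =>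
    Integrable.of_bound (hpm c).aestronglyMeasurable 1 (ae_of_all _ fun θ => by
      rw [Real.norm_of_nonneg ENNReal.toReal_nonneg]
      exact measureReal_le_one)
  have hterm : ∀ c, Integrable (fun θ => (k θ c : ℝ) * Real.log (t c) + k θ c -
      m * (p θ c).toReal * t c) μ := fun c =>
    (((hki c).mul_const _).add (hki c)).sub (((hpi c).const_mul _).mul_const _)
  have hψm : Measurable fun θ => ∑ c, ((k θ c : ℝ) * Real.log (t c) + k θ c -
      m * (p θ c).toReal * t c) := Finset.measurable_sum _ fun c _ =>
    (((hkm c).mul_const _).add (hkm c)).sub (((hpm c).const_mul _).mul_const _)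
  -- The exponential of the sum is a product over the classes, bounded factor by factor by `expKl`.
  -- Hence `hS` supplies the exponential moment for any fixed `t`.
  have hDV := integral_le_toReal_klDiv_add_log μ ν hkl hψm
    (integrable_finsetSum _ fun c _ => hterm c) hB (le_trans (lintegral_mono fun θ => by
      rw [Real.exp_sum, ENNReal.ofReal_prod_of_nonneg fun _ _ => (Real.exp_pos _).le]
      exact Finset.prod_le_prod' fun c _ =>
        ofReal_exp_le_pow m hm (k θ c) (measure_ne_top D _) (ht c)) hS)
  rw [le_div_iff₀ hm']
  refine le_trans (le_of_eq ?_) hDV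
  rw [integral_finsetSum _ fun c _ => hterm c, Finset.sum_mul]
  refine Finset.sum_congr rfl fun c _ => ?_
  rw [integral_sub (((hki c).mul_const _).fun_add (hki c)) (((hpi c).const_mul _).mul_const _),
    integral_add ((hki c).mul_const _) (hki c), integral_mul_const, integral_mul_const,
    integral_const_mul, integral_toReal_classProb D μ hcat c, integral_count μ hcat S c]
  field_simp

end ClassFreq

/-! ### Pairs of voters and their three classes -/

section Voters

variable {X H : Type*} {vote : H → X → Label}

/-- The class of a labelled point for a pair of voters: both err, they disagree, or both are
right. -/
def pairClass (vote : H → X → Label) (h : H × H) (z : X × Label) : Fin 3 :=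
  if vote h.1 z.1 ≠ z.2 then if vote h.2 z.1 ≠ z.2 then 0 else 1
  else if vote h.2 z.1 ≠ z.2 then 1 else 2

lemma ind_pairClass_zero (h₁ h₂ : H) (z : X × Label) :
    ind (pairClass vote (h₁, h₂) z = 0) = ind (vote h₁ z.1 ≠ z.2) * ind (vote h₂ z.1 ≠ z.2) := by
  by_cases e1 : vote h₁ z.1 = z.2 <;> by_cases e2 : vote h₂ z.1 = z.2 <;>
    simp [pairClass, ind, e1, e2]

lemma ind_pairClass_one (h₁ h₂ : H) (z : X × Label) :
    ind (pairClass vote (h₁, h₂) z = 1) = ind (vote h₁ z.1 ≠ z.2) + ind (vote h₂ z.1 ≠ z.2) -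
      2 * (ind (vote h₁ z.1 ≠ z.2) * ind (vote h₂ z.1 ≠ z.2)) := by
  by_cases e1 : vote h₁ z.1 = z.2 <;> by_cases e2 : vote h₂ z.1 = z.2 <;>
    simp [pairClass, ind, e1, e2]
  norm_num

lemma ind_pairClass_two (h₁ h₂ : H) (z : X × Label) :
    ind (pairClass vote (h₁, h₂) z = 2) = 1 - ind (pairClass vote (h₁, h₂) z = 0) -
      ind (pairClass vote (h₁, h₂) z = 1) := by
  by_cases e1 : vote h₁ z.1 = z.2 <;> by_cases e2 : vote h₂ z.1 = z.2 <;>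
    simp [pairClass, ind, e1, e2]

/-- With only two labels, two voters disagree exactly when one of them errs, whatever the true label
is. -/
lemma ind_vote_ne_vote (h₁ h₂ : H) (z : X × Label) :
    ind (vote h₁ z.1 ≠ vote h₂ z.1) = ind (pairClass vote (h₁, h₂) z = 1) := by
  have key : ∀ a b y : Label, (a ≠ b ↔ (a ≠ y ∧ b = y ∨ a = y ∧ b ≠ y)) := by decide
  have h := key (vote h₁ z.1) (vote h₂ z.1) z.2
  by_cases e1 : vote h₁ z.1 = z.2 <;> by_cases e2 : vote h₂ z.1 = z.2 <;>
    simp [pairClass, ind, e1, e2] <;> simp_all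

variable [MeasurableSpace H]

/-- The `Q`-probability that a voter errs on the labelled point `z`. -/
noncomputable def errProb (vote : H → X → Label) (Q : Measure H) (z : X × Label) : ℝ :=
  ∫ h, ind (vote h z.1 ≠ z.2) ∂Q

lemma errProb_nonneg (Q : Measure H) (z : X × Label) : 0 ≤ errProb vote Q z := integral_nonneg fun _ => ind_nonneg _

lemma errProb_le_one (Q : Measure H) [IsProbabilityMeasure Q] (z : X × Label) : errProb vote Q z ≤ 1 := by
  have h : ‖errProb vote Q z‖ ≤ 1 * Q.real Set.univ :=
    norm_integral_le_of_norm_le_const (ae_of_all _ fun h => by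
      rw [Real.norm_of_nonneg (ind_nonneg _)]
      exact ind_le_one _)
  simpa using (le_abs_self _).trans h

variable [MeasurableSpace X]

lemma measurableSet_vote_ne (hvote : Measurable (Function.uncurry vote)) {α : Type*}
    [MeasurableSpace α] {f : α → H} {g : α → X × Label} (hf : Measurable f) (hg : Measurable g) :
    MeasurableSet {a | vote (f a) (g a).1 ≠ (g a).2} :=
  (measurableSet_eq_fun (hvote.comp (hf.prodMk (measurable_fst.comp hg)))
    (measurable_snd.comp hg)).compl

lemma measurable_pairClass (hvote : Measurable (Function.uncurry vote)) :
    Measurable (Function.uncurry (pairClass vote)) := by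
  have h1 := measurableSet_vote_ne hvote (α := (H × H) × (X × Label))
    (measurable_fst.comp measurable_fst) measurable_snd
  have h2 := measurableSet_vote_ne hvote (α := (H × H) × (X × Label))
    (measurable_snd.comp measurable_fst) measurable_snd
  exact Measurable.ite h1 (Measurable.ite h2 measurable_const measurable_const)
    (Measurable.ite h2 measurable_const measurable_const)

variable (Q : Measure H) [IsProbabilityMeasure Q]

lemma integrable_vote_ne (hvote : Measurable (Function.uncurry vote)) (z : X × Label) :
    Integrable (fun h => ind (vote h z.1 ≠ z.2)) Q :=
  integrable_ind Q (measurableSet_vote_ne hvote measurable_id measurable_const)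

lemma integrable_pairClass (hvote : Measurable (Function.uncurry vote)) (c : Fin 3)
    (z : X × Label) :
    Integrable (fun h => ind (pairClass vote h z = c)) (Q.prod Q) :=
  integrable_ind _ (measurableSet_cat (measurable_pairClass hvote) c z)

/-- The two voters are drawn independently, so the probability that both err factorises. -/
lemma classFreq_zero (hvote : Measurable (Function.uncurry vote)) (z : X × Label) :
    classFreq (pairClass vote) (Q.prod Q) 0 z = errProb vote Q z ^ 2 := by
  rw [classFreq, integral_prod _ (integrable_pairClass Q hvote 0 z)]
  simp only [ind_pairClass_zero, integral_const_mul, integral_mul_const, errProb]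
  ring

lemma classFreq_one (hvote : Measurable (Function.uncurry vote)) (z : X × Label) :
    classFreq (pairClass vote) (Q.prod Q) 1 z =
      2 * errProb vote Q z - 2 * errProb vote Q z ^ 2 := by
  have hi := integrable_vote_ne Q hvote z
  rw [classFreq, integral_prod _ (integrable_pairClass Q hvote 1 z)]
  have h1 : ∀ h₁, ∫ h₂, ind (pairClass vote (h₁, h₂) z = 1) ∂Q = ind (vote h₁ z.1 ≠ z.2) +
      errProb vote Q z - 2 * (ind (vote h₁ z.1 ≠ z.2) * errProb vote Q z) := fun h₁ => by
    simp only [ind_pairClass_one]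
    rw [integral_sub ((integrable_const _).fun_add hi) ((hi.const_mul _).const_mul _),
      integral_add (integrable_const _) hi, integral_const_mul, integral_const_mul]
    simp [errProb]
  simp only [h1]
  rw [integral_sub (hi.fun_add (integrable_const _)) ((hi.mul_const _).const_mul _),
      integral_add hi (integrable_const _), integral_const_mul, integral_mul_const]
  change errProb vote Q z + ∫ _, errProb vote Q z ∂Q - 2 * (errProb vote Q z * _) = _
  simp
  ring

lemma classFreq_two (hvote : Measurable (Function.uncurry vote)) (z : X × Label) :
    classFreq (pairClass vote) (Q.prod Q) 2 z = 1 - classFreq (pairClass vote) (Q.prod Q) 0 z -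
      classFreq (pairClass vote) (Q.prod Q) 1 z := by
  have h0 := integrable_pairClass Q hvote 0 z
  have h1 := integrable_pairClass Q hvote 1 z
  unfold classFreq
  have h2 : ∀ h : H × H, ind (pairClass vote h z = 2) =
    1 - ind (pairClass vote h z = 0) - ind (pairClass vote h z = 1) :=
    fun h => ind_pairClass_two h.1 h.2 z
  simp only [h2]
  have h01 : Integrable (fun h => 1 - ind (pairClass vote h z = 0)) (Q.prod Q) :=
    (integrable_const 1).sub h0
  rw [integral_sub h01 h1, integral_sub (integrable_const _) h0]
  simp

lemma measurable_errProb (hvote : Measurable (Function.uncurry vote)) :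
    Measurable (errProb vote Q) :=
  ((measurable_ind (p := fun x : (X × Label) × H => vote x.2 x.1.1 ≠ x.1.2)
    (measurableSet_vote_ne hvote measurable_snd
      measurable_fst)).stronglyMeasurable.integral_prod_right').measurable

lemma empJointError_eq (hvote : Measurable (Function.uncurry vote)) {m : ℕ}
    (S : Fin m → X × Label) :
    empJointError vote S Q =
      1 / (m : ℝ) * ∑ i, classFreq (pairClass vote) (Q.prod Q) 0 (S i) := by
  unfold empJointError classFreq
  congr 1
  refine Finset.sum_congr rfl fun i _ => ?_
  rw [integral_prod _ (integrable_pairClass Q hvote 0 (S i))]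
  simp only [ind_pairClass_zero]

lemma empDisagreement_eq (hvote : Measurable (Function.uncurry vote)) {m : ℕ}
    (S : Fin m → X × Label) :
    empDisagreement vote S Q =
      1 / (m : ℝ) * ∑ i, classFreq (pairClass vote) (Q.prod Q) 1 (S i) := by
  unfold empDisagreement classFreq
  congr 1
  refine Finset.sum_congr rfl fun i _ => ?_
  rw [integral_prod _ (integrable_pairClass Q hvote 1 (S i))]
  simp only [ind_vote_ne_vote]

variable (D : Measure (X × Label)) [IsProbabilityMeasure D]

lemma gibbsRisk_eq (hvote : Measurable (Function.uncurry vote)) :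
    gibbsRisk vote D Q = ∫ z, errProb vote Q z ∂D := by
  unfold gibbsRisk errProb
  exact integral_integral_swap (integrable_ind (Q.prod D)
    (p := fun x : H × (X × Label) => vote x.1 x.2.1 ≠ x.2.2)
    (measurableSet_vote_ne hvote measurable_fst measurable_snd))

lemma disagreement_eq (hvote : Measurable (Function.uncurry vote)) :
    disagreement vote D Q = ∫ z, classFreq (pairClass vote) (Q.prod Q) 1 z ∂D := by
  have hcat := measurable_pairClass hvote
  have hI := integrable_ind ((Q.prod Q).prod D)
    (p := fun x : (H × H) × (X × Label) => pairClass vote x.1 x.2 = 1)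
    (hcat (measurableSet_singleton 1))
  unfold classFreq
  rw [← integral_integral_swap (f := fun (h : H × H) z => ind (pairClass vote h z = 1)) hI,
    integral_prod _ hI.integral_prod_left]
  unfold disagreement
  refine integral_congr_ae (ae_of_all _ fun h₁ => integral_congr_ae (ae_of_all _ fun h₂ => ?_))
  have hm : MeasurableSet {x | vote h₁ x ≠ vote h₂ x} :=
    (measurableSet_eq_fun (hvote.comp measurable_prodMk_left)
      (hvote.comp measurable_prodMk_left)).compl
  change ∫ x, ind (vote h₁ x ≠ vote h₂ x) ∂D.fst = _
  rw [Measure.fst, integral_map measurable_fst.aemeasurable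
    (measurable_ind hm).aestronglyMeasurable]
  simp only [ind_vote_ne_vote]

end Voters

/-! ### The true pair lies in the confidence set -/

section Bound

variable {X H : Type*} [MeasurableSpace X] [MeasurableSpace H] {vote : H → X → Label}

lemma klDiv_prod_add_log_div_le_kappa (P Q : Measure H) [IsProbabilityMeasure P]
    [IsProbabilityMeasure Q] (h : InformationTheory.klDiv Q P ≠ ⊤) (m : ℕ) (δ : ℝ) :
    ((((InformationTheory.klDiv (Q.prod Q) (P.prod P)).toReal +
      Real.log ((2 * Real.sqrt m + m) / δ)) / m : ℝ) : EReal) ≤ kappa m δ P Q := by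
  rw [klDiv_prod_self, ENNReal.toReal_mul, kappa]
  rw [← EReal.coe_ennreal_toReal h]
  rw [EReal.coe_div, EReal.coe_add, EReal.coe_mul]
  exact le_of_eq rfl

lemma kappa_eq_top (P Q : Measure H) (h : InformationTheory.klDiv Q P = ⊤) {m : ℕ} (hm : 0 < m)
    (δ : ℝ) : kappa m δ P Q = ⊤ := by
  have hm' : (0 : EReal) < m := by exact_mod_cast hm
  rw [kappa, h, EReal.coe_ennreal_top, EReal.mul_top_of_pos (by norm_num), EReal.top_add_coe]
  exact EReal.top_div_of_pos_ne_top hm' (EReal.natCast_ne_top m)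

/-- The PAC-Bayesian bound on the joint error and the disagreement, for a sample on which the prior
average of the exponential divergence is small. -/
lemma trinomialKl_le_kappa (hvote : Measurable (Function.uncurry vote))
    (D : Measure (X × Label)) [IsProbabilityMeasure D] (P Q : Measure H) [IsProbabilityMeasure P]
    [IsProbabilityMeasure Q] {m : ℕ} (hm : 0 < m) {δ : ℝ} (hδ : 0 < δ) (S : Fin m → X × Label)
    (hS : ∫⁻ θ, expKl (fun i => pairClass vote θ (S i))
      (fun c => D (pairClass vote θ ⁻¹' {c})) ∂(P.prod P) ≤
        ENNReal.ofReal ((2 * Real.sqrt m + m) / δ)) :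
    trinomialKl (empJointError vote S Q) (empDisagreement vote S Q)
      (∫ z, classFreq (pairClass vote) (Q.prod Q) 0 z ∂D)
      (∫ z, classFreq (pairClass vote) (Q.prod Q) 1 z ∂D) ≤ kappa m δ P Q := by
  -- An infinite divergence makes `κ(Q) = ⊤`. It is set aside because the real-valued bound uses
  -- `toReal`, which would send it to `0`.
  by_cases hkl : InformationTheory.klDiv Q P = ⊤
  · rw [kappa_eq_top P Q hkl hm]
    exact le_top
  have hm' : (0 : ℝ) < m := by exact_mod_cast hm
  have hcat := measurable_pairClass hvote
  have hkl2 : InformationTheory.klDiv (Q.prod Q) (P.prod P) ≠ ⊤ := by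
    rw [klDiv_prod_self]
    exact ENNReal.mul_ne_top (by norm_num) hkl
  have hfi : ∀ c, Integrable (classFreq (pairClass vote) (Q.prod Q) c) D := fun c =>
    (integrable_ind (D.prod (Q.prod Q))
      (p := fun x : (X × Label) × (H × H) => pairClass vote x.2 x.1 = c)
      ((hcat.comp measurable_swap) (measurableSet_singleton c))).integral_prod_left
  have htan := klTerm_add_klTerm_add_klTerm_le
    (q := fun c => 1 / (m : ℝ) * ∑ i, classFreq (pairClass vote) (Q.prod Q) c (S i))
    (p := fun c => ∫ z, classFreq (pairClass vote) (Q.prod Q) c z ∂D)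
    (fun c => mul_nonneg (by positivity)
      (Finset.sum_nonneg fun i _ => classFreq_nonneg (pairClass vote) _ c (S i)))
    (fun c => integral_nonneg fun z => classFreq_nonneg (pairClass vote) _ c z)
    (fun t ht => (EReal.coe_le_coe_iff.mpr (sum_tangent_le D (Q.prod Q) (P.prod P) hcat hm S
      (by positivity) hS hkl2 t ht)).trans (klDiv_prod_add_log_div_le_kappa P Q hkl m δ))
  have hq2 : 1 / (m : ℝ) * ∑ i, classFreq (pairClass vote) (Q.prod Q) 2 (S i) =
      1 - empJointError vote S Q - empDisagreement vote S Q := by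
    rw [empJointError_eq Q hvote, empDisagreement_eq Q hvote]
    simp only [classFreq_two Q hvote, Finset.sum_sub_distrib, Finset.sum_const, Finset.card_univ,
      Fintype.card_fin, nsmul_eq_mul, mul_one, mul_sub]
    rw [one_div_mul_cancel hm'.ne']
  have hp2 : ∫ z, classFreq (pairClass vote) (Q.prod Q) 2 z ∂D =
      1 - ∫ z, classFreq (pairClass vote) (Q.prod Q) 0 z ∂D -
        ∫ z, classFreq (pairClass vote) (Q.prod Q) 1 z ∂D := by
    have h01 : Integrable (fun z => 1 - classFreq (pairClass vote) (Q.prod Q) 0 z) D :=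
      (integrable_const 1).sub (hfi 0)
    simp only [classFreq_two Q hvote]
    rw [integral_sub h01 (hfi 1), integral_sub (integrable_const 1) (hfi 0)]
    simp
  simp only [hq2, hp2, ← empJointError_eq Q hvote, ← empDisagreement_eq Q hvote] at htan
  exact htan

/-- The true joint error and disagreement satisfy the constraints that define `setAHat`, and the
C-Bound is `cL` of them. -/
lemma exists_mem_setAHat_cBound_eq (hvote : Measurable (Function.uncurry vote))
    (D : Measure (X × Label)) [IsProbabilityMeasure D] (P Q : Measure H) [IsProbabilityMeasure P]
    [IsProbabilityMeasure Q] {m : ℕ} (hm : 0 < m) {δ : ℝ} (hδ : 0 < δ) (S : Fin m → X × Label)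
    (hS : ∫⁻ θ, expKl (fun i => pairClass vote θ (S i))
      (fun c => D (pairClass vote θ ⁻¹' {c})) ∂(P.prod P) ≤
        ENNReal.ofReal ((2 * Real.sqrt m + m) / δ))
    (hr : gibbsRisk vote D Q < 1 / 2) :
    ∃ p ∈ setAHat vote S δ P Q, cBound vote D Q = cL p.1 p.2 := by
  have hkl := trinomialKl_le_kappa hvote D P Q hm hδ S hS
  set W := errProb vote Q with hW
  have hW0 : ∀ z, 0 ≤ W z := errProb_nonneg Q
  have hW1 : ∀ z, W z ≤ 1 := errProb_le_one Q
  have hWm : Measurable W := measurable_errProb Q hvote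
  have hWi : Integrable W D := Integrable.of_bound hWm.aestronglyMeasurable 1
    (ae_of_all _ fun z => by
      rw [Real.norm_of_nonneg (hW0 z)]
      exact hW1 z)
  have hW2i : Integrable (fun z => W z ^ 2) D :=
    Integrable.of_bound (hWm.pow_const 2).aestronglyMeasurable 1 (ae_of_all _ fun z => by
      rw [Real.norm_of_nonneg (sq_nonneg _)]
      exact pow_le_one₀ (hW0 z) (hW1 z))
  set r := ∫ z, W z ∂D with hrdef
  set e := ∫ z, W z ^ 2 ∂D with hedef
  have hrisk : gibbsRisk vote D Q = r := gibbsRisk_eq Q D hvote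
  have he : ∫ z, classFreq (pairClass vote) (Q.prod Q) 0 z ∂D = e := by
    simp only [classFreq_zero Q hvote]
    rfl
  have hd : ∫ z, classFreq (pairClass vote) (Q.prod Q) 1 z ∂D = 2 * r - 2 * e := by
    simp only [classFreq_one Q hvote]
    rw [integral_sub (hWi.const_mul 2) (hW2i.const_mul 2), integral_const_mul, integral_const_mul]
  have hdis : disagreement vote D Q = 2 * r - 2 * e := (disagreement_eq Q D hvote).trans hd
  rw [he, hd] at hkl
  rw [hrisk] at hr
  have hr0 : 0 ≤ r := integral_nonneg hW0
  have he0 : 0 ≤ e := integral_nonneg fun z => sq_nonneg _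
  have her : e ≤ r := integral_mono hW2i hWi fun z => by
    change W z ^ 2 ≤ W z
    nlinarith [hW0 z, hW1 z]
  -- Jensen's inequality for the square.
  have hre : r ^ 2 ≤ e :=
    (even_two.convexOn_pow (𝕜 := ℝ)).map_integral_le (continuous_pow 2).continuousOn isClosed_univ
      (ae_of_all _ fun _ => Set.mem_univ _) hWi hW2i
  refine ⟨(e, 2 * r - 2 * e), ⟨⟨he0, by simpa using her, ?_, hkl⟩, ?_, ?_⟩, ?_⟩
  · change e + (2 * r - 2 * e) ≤ 1
    -- `e + d = 2r - e ≤ 2r - r² = 1 - (1 - r)²`.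
    nlinarith [sq_nonneg (1 - r)]
  · change 2 * r - 2 * e ≤ 2 * Real.sqrt (min e (1 / 4)) - 2 * e
    -- Both `r² ≤ e` and `r < 1/2` enter here, the latter through the cap `1/4`.
    have : r ≤ Real.sqrt (min e (1 / 4)) :=
      Real.le_sqrt_of_sq_le (le_min hre (by nlinarith))
    linarith
  · change 2 * r - 2 * e < 1 / 2
    -- `d ≤ 2r - 2r² = 1/2 - 2(1/2 - r)²`, strictly below `1/2`.
    nlinarith [mul_pos (sub_pos.mpr hr) (sub_pos.mpr hr)]
  · rw [cBound, cL, hrisk, hdis]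
    ring_nf

end Bound

end PacBayes

theorem theorem6 {X H : Type*} [MeasurableSpace X] [MeasurableSpace H]
    (vote : H → X → PacBayes.Label)
    (hvote : Measurable (Function.uncurry vote))
    (D : Measure (X × PacBayes.Label)) [IsProbabilityMeasure D]
    (P : Measure H) [IsProbabilityMeasure P]
    (m : ℕ) (hm : 0 < m) (δ : ℝ) (hδ : 0 < δ) :
    ∃ G : Set (Fin m → X × PacBayes.Label), MeasurableSet G ∧
      1 - δ ≤ (Measure.pi (fun _ : Fin m => D)).real G ∧
      ∀ S ∈ G, ∀ Q : Measure H, IsProbabilityMeasure Q →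
        PacBayes.gibbsRisk vote D Q < 1 / 2 →
        ((PacBayes.cBound vote D Q : ℝ) : EReal) ≤
          ⨆ p ∈ PacBayes.setAHat vote S δ P Q, ((PacBayes.cL p.1 p.2 : ℝ) : EReal) := by
  obtain ⟨G, hGm, hG, hS⟩ := PacBayes.exists_measurableSet_lintegral_expKl_le D (P.prod P)
    (PacBayes.measurable_pairClass hvote) hm hδ
  refine ⟨G, hGm, hG, fun S hSG Q _ hr => ?_⟩
  obtain ⟨p, hp, hpc⟩ := PacBayes.exists_mem_setAHat_cBound_eq hvote D P Q hm hδ S (hS S hSG) hr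
  rw [hpc]
  exact le_iSup₂ (f := fun p (_ : p ∈ PacBayes.setAHat vote S δ P Q) =>
    ((PacBayes.cL p.1 p.2 : ℝ) : EReal)) p hp
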